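/- Let $\pi=(\pi^{ij})$ be a smooth Poisson structure on $\mathbb{R}^d$. **Kontsevich trees, symbols, weights.** A Kontsevich graph of type $(n,2)$ has aerial vertices $1,\dots,n$ and terrestrial vertices $\bar 1,\bar 2$; exactly two ordered edges $e_k^1,e_k^2$ leave each aerial vertex $k$, with distinct targets different from $k$, and no edge leaves a terrestrial vertex. It is a Kontsevich tree if the graph formed by its aerial vertices and the edges between them is a tree (connected and without cycles, the orientation being forgotten); $T_{n,2}$ is the set of Kontsevich trees of type $(n,2)$. For such a graph $\Gamma$ with edge set $E_\Gamma$ put $$B_\Gamma(\pi)(f_1,f_2)=\sum_{I:E_\Gamma\to\{1,\dots,d\}}\Big[\prod_{k=1}^n\Big(\prod_{e=(*,k)}\partial_{I(e)}\Big)\pi^{I(e_k^1)I(e_k^2)}\Big]\prod_{a=1}^{2}\Big(\prod_{e=(*,\bar a)}\partial_{I(e)}\Big)f_a ,$$ where $e=(*,v)$ runs over the edges with target $v$, and define the symbol $\hat B_\Gamma(\pi)$ by $B_\Gamma(\pi)(e^{p_1x},e^{p_2x})=\hat B_\Gamma(\pi)(p_1,p_2,x)\,e^{(p_1+p_2)x}$.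 The weight of $\Gamma$ is $$W_\Gamma=\int_{M_n}\bigwedge_{k=1}^n d\phi_k^1\wedge d\phi_k^2 ,$$ where $M_n$ is the space of $n$-tuples $(z_1,\dots,z_n)$ of distinct points of the open upper half plane, oriented by $dx_1\wedge dy_1\wedge\dots\wedge dx_n\wedge dy_n$ with $z_k=x_k+iy_k$; $\phi_k^j=\phi(z_k,z_v)$ if $v$ is the target of $e_k^j$, with $z_{\bar 1}=0$ and $z_{\bar 2}=1$; and $\phi(p,q)=\frac1{2\pi}\arg\frac{q-p}{q-\bar p}\in[0,1)$. **The Kontsevich realization.** Let $$S_{\frac\pi2}(p_1,p_2,x)=(p_1+p_2)x+\sum_{n\ge1}\frac{\epsilon^n}{n!}\sum_{\Gamma\in T_{n,2}}W_\Gamma\,\hat B_\Gamma\big(\tfrac\pi2\big)(p_1,p_2,x),\qquad s_K^i(p,x)=\frac{\partial S_{\frac\pi2}}{\partial p_{2,i}}(p,0,x),$$ formal power series in $\epsilon$ whose coefficients are functions of $(p_1,p_2,x)$ and of $(p,x)$, respectively. **Rooted trees.** A rooted tree is a finite directed graph that is a tree and has a distinguished vertex, the root, towards which all edges are oriented; $[RT]$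 is the set of isomorphism classes of rooted trees. For a rooted tree $t$, let $|t|$ be its number of vertices and $\operatorname{sym}(t)$ its automorphism group. Let $\Gamma_t$ be the Kontsevich tree with interior $t$ such that the first edge of every aerial vertex lands on $\bar 1$, the second edge of the root lands on $\bar 2$, and the second edge of any other vertex is its edge in $t$; put $W_t=W_{\Gamma_t}$. For a vector field $X=X^u\partial_u$ on $\mathbb{R}^d$, the elementary differential is defined recursively by $D_\bullet^uX=X^u$ and, if $t$ is obtained by grafting the roots of $t_1,\dots,t_m$ to a new root, $$D_t^uX=\sum_{i_1,\dots,i_m}\partial_{i_1}\cdots\partial_{i_m}X^u\;D_{t_1}^{i_1}X\cdots D_{t_m}^{i_m}X .$$ **Theorem.** Let $L_V=\sum_{i,j}\pi^{ij}(x)p_i\,\partial_{x^j}$, a vector field on $\mathbb{R}^d$ depending on the parameter $p$. Then, for $i=1,\dots,d$, $$s_K^i(p,x)=x^i+\sum_{t\in[RT]}\epsilon^{|t|}\,\frac{W_t}{|\operatorname{sym}(t)|}\,D_t^iL_V$$ as formal power series in $\epsilon$, where $W_t$, $|\operatorname{sym}(t)|$ and $D_t^iL_V$ are computed from any representative of the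 class $t$. -/

import Mathlib

open scoped ContDiff PowerSeries PowerSeries.WithPiTopology

noncomputable section

/-! ### Partial derivatives and Poisson structures on `ℝ^d` -/

/-- The partial derivative `∂_i f`. -/
def partialDeriv {d : ℕ} (i : Fin d) (f : (Fin d → ℝ) → ℝ) : (Fin d → ℝ) → ℝ :=
  fun x => fderiv ℝ f x (Pi.single i 1)

/-- The iterated partial derivative `∂_{i_1} ⋯ ∂_{i_m} f`. It is only applied to smooth functions,
for which the order of the indices is immaterial. -/
def iterPartialDeriv {d : ℕ} (l : List (Fin d)) (f : (Fin d → ℝ) → ℝ) : (Fin d → ℝ) → ℝ :=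
  l.foldr partialDeriv f

/-- A smooth Poisson structure on `ℝ^d`, given by its components `π^{ij}(x) = coeff x i j`. -/
structure PoissonStructure (d : ℕ) where
  coeff : (Fin d → ℝ) → Fin d → Fin d → ℝ
  smooth : ∀ i j, ContDiff ℝ ∞ (fun x => coeff x i j)
  antisymm : ∀ x i j, coeff x i j = -coeff x j i
  jacobi : ∀ x i j k, ∑ l,
    (coeff x i l * partialDeriv l (fun y => coeff y j k) x
      + coeff x j l * partialDeriv l (fun y => coeff y k i) x
      + coeff x k l * partialDeriv l (fun y => coeff y i j) x) = 0

/-- The vector field `L_V = π^{ij}(x) p_i ∂_{x^j}` on `ℝ^d`, depending on the parameter `p`. -/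
def PoissonStructure.flatSpray {d : ℕ} (π : PoissonStructure d) (p : Fin d → ℝ) :
    (Fin d → ℝ) → Fin d → ℝ :=
  fun x j => ∑ i, π.coeff x i j * p i

/-! ### Oriented trees -/

/-- The directed graph `(V, E)` is a tree: it has no loops and no pair of antiparallel edges (that
would be a cycle of length two), and the underlying undirected graph is connected and acyclic. -/
def IsOrientedTree {V : Type*} (E : V → V → Prop) : Prop :=
  (∀ v w, E v w → ¬ E w v) ∧ (SimpleGraph.fromRel E).IsTree

/-! ### Kontsevich graphs, operators and weights -/

/-- Kontsevich graphs of type `(n, m)`: aerial vertices `Fin n`, terrestrial vertices `Fin m`; the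
target of the edge `e_k^1`, `e_k^2` is `γ k 0`, `γ k 1`. There are no loops, and the two edges
leaving a vertex are different (so they have different targets, since the edges form a subset of
the set of pairs of vertices). -/
def KontsevichGraph (n m : ℕ) : Type :=
  {γ : Fin n → Fin 2 → Fin n ⊕ Fin m // ∀ k, (∀ j, γ k j ≠ Sum.inl k) ∧ γ k 0 ≠ γ k 1}

namespace KontsevichGraph

variable {n m : ℕ}

instance : Fintype (KontsevichGraph n m) := by
  classical
  unfold KontsevichGraph
  infer_instance

/-- The target of the edge `e = (k, j)`, the `j`-th edge leaving the aerial vertex `k`. -/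
def target (Γ : KontsevichGraph n m) (e : Fin n × Fin 2) : Fin n ⊕ Fin m :=
  Γ.1 e.1 e.2

/-- The edges of the interior of `Γ`, i.e. the aerial edges. -/
def interior (Γ : KontsevichGraph n m) (k l : Fin n) : Prop :=
  ∃ j, Γ.target (k, j) = Sum.inl l

/-- `Γ` is a Kontsevich tree. -/
def IsTree (Γ : KontsevichGraph n m) : Prop :=
  IsOrientedTree Γ.interior

open Classical in
/-- The list of the edges landing on the vertex `v`. -/
def incoming (Γ : KontsevichGraph n m) (v : Fin n ⊕ Fin m) : List (Fin n × Fin 2) :=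
  (Finset.univ.filter fun e => Γ.target e = v).toList

/-- The Kontsevich operator `B_Γ(π)(f_1, …, f_m)`. -/
def operator {d : ℕ} (Γ : KontsevichGraph n m) (π : (Fin d → ℝ) → Fin d → Fin d → ℝ)
    (f : Fin m → (Fin d → ℝ) → ℝ) (x : Fin d → ℝ) : ℝ :=
  ∑ I : Fin n × Fin 2 → Fin d,
    (∏ k : Fin n, iterPartialDeriv ((Γ.incoming (Sum.inl k)).map I)
        (fun y => π y (I (k, 0)) (I (k, 1))) x)
      * ∏ a : Fin m, iterPartialDeriv ((Γ.incoming (Sum.inr a)).map I) (f a) x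

/-- The symbol `B̂_Γ(π)(p_1, …, p_m, x)` of `B_Γ(π)`, determined by
`B_Γ(π)(e^{p_1 x}, …, e^{p_m x}) = B̂_Γ(π)(p_1, …, p_m, x) e^{(p_1 + ⋯ + p_m) x}`. -/
def symbol {d : ℕ} (Γ : KontsevichGraph n m) (π : (Fin d → ℝ) → Fin d → Fin d → ℝ)
    (p : Fin m → Fin d → ℝ) (x : Fin d → ℝ) : ℝ :=
  Γ.operator π (fun a y => Real.exp (p a ⬝ᵥ y)) x / Real.exp ((∑ a, p a) ⬝ᵥ x)

end KontsevichGraph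

/-- The angle `φ(p, q) ∈ [0, 1)`, in units of a full turn: the angle at `p`, counted
counterclockwise, from the hyperbolic half-line from `p` to `i∞` to the hyperbolic half-line
from `p` to `q`. For real `q` it is `arg (p - q) / π`. -/
def hyperbolicAngle (p q : ℂ) : ℝ :=
  Int.fract (Complex.arg ((q - p) / (q - starRingEnd ℂ p)) / (2 * Real.pi))

namespace KontsevichGraph

variable {n : ℕ}

/-- The position of a vertex in a configuration `z` of the aerial vertices; the two terrestrial
vertices sit at `0` and `1`. -/
def position (z : Fin n → ℂ) : Fin n ⊕ Fin 2 → ℂ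
  | Sum.inl k => z k
  | Sum.inr a => ((a : ℕ) : ℂ)

/-- The angle function `φ_k^j` of the edge `e = (k, j)` on the configuration space. -/
def edgeAngle (Γ : KontsevichGraph n 2) (e : Fin n × Fin 2) (z : Fin n → ℂ) : ℝ :=
  hyperbolicAngle (z e.1) (position z (Γ.target e))

/-- The manifold of configurations: `n` distinct points in the open upper half plane. -/
def configurations (n : ℕ) : Set (Fin n → ℂ) :=
  {z | (∀ k, 0 < (z k).im) ∧ Function.Injective z}

/-- The coordinate vector fields `∂/∂x_l` (for `b = (l, 0)`) and `∂/∂y_l` (for `b = (l, 1)`) on `ℂ^n`,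
where `z_l = x_l + i y_l`. -/
def coordVector (b : Fin n × Fin 2) : Fin n → ℂ :=
  Pi.single b.1 (![1, Complex.I] b.2)

/-- The coefficient of the angle form `⋀_k dφ_k^1 ∧ dφ_k^2` with respect to
`dx_1 ∧ dy_1 ∧ ⋯ ∧ dx_n ∧ dy_n`. (An angle function jumps by an integer on the null set where the
head of an aerial edge is vertically above its tail; this does not affect the integral below.) -/
def angleForm (Γ : KontsevichGraph n 2) (z : Fin n → ℂ) : ℝ :=
  Matrix.det (Matrix.of fun e b : Fin n × Fin 2 => fderiv ℝ (Γ.edgeAngle e) z (coordVector b))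

/-- The Kontsevich weight `W_Γ`, the integral of the angle form over the configuration space,
oriented by `dx_1 ∧ dy_1 ∧ ⋯ ∧ dx_n ∧ dy_n` (the boundary of its compactification is a null set).
The angles are normalized to `[0, 1)` and there is no factor `1 / n!`. -/
def weight (Γ : KontsevichGraph n 2) : ℝ :=
  ∫ z in configurations n, Γ.angleForm z

end KontsevichGraph

/-! ### The generating function and the Kontsevich realization -/

open Classical in
/-- The formal generating function, a power series in `ε` whose coefficients are functions of
`(p_1, p_2, x)`:
`S_π = (p_1 + p_2) x + ∑_{n ≥ 1} ε^n / n! ∑_{Γ ∈ T_{n,2}} W_Γ B̂_Γ(π)(p_1, p_2, x)`. -/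
def generatingFunction {d : ℕ} (π : (Fin d → ℝ) → Fin d → Fin d → ℝ) :
    ((Fin d → ℝ) → (Fin d → ℝ) → (Fin d → ℝ) → ℝ)⟦X⟧ :=
  PowerSeries.mk fun n p₁ p₂ x =>
    if n = 0 then (p₁ + p₂) ⬝ᵥ x
    else (1 / (n.factorial : ℝ)) *
      ∑ Γ : {Γ : KontsevichGraph n 2 // Γ.IsTree}, Γ.1.weight * Γ.1.symbol π ![p₁, p₂] x

/-- The `i`-th component of the Kontsevich realization `s_K(p, x) = ∂S_{π/2}/∂p_2 (p, 0, x)`, a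
power series in `ε` whose coefficients are functions of `(p, x)`. -/
def kontsevichRealization {d : ℕ} (π : PoissonStructure d) (i : Fin d) :
    ((Fin d → ℝ) → (Fin d → ℝ) → ℝ)⟦X⟧ :=
  PowerSeries.mk fun n p x =>
    partialDeriv i
      (fun p₂ => PowerSeries.coeff n (generatingFunction fun y j k => π.coeff y j k / 2) p p₂ x) 0

/-! ### Rooted trees -/

/-- Rooted trees with vertex set `Fin n`: the head of each edge is nearer to the root than its
tail. -/
structure LabeledRootedTree (n : ℕ) where
  Edge : Fin n → Fin n → Prop
  root : Fin n
  isTree : IsOrientedTree Edge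
  toward_root : ∀ v w, Edge v w →
    (SimpleGraph.fromRel Edge).dist w root < (SimpleGraph.fromRel Edge).dist v root

namespace LabeledRootedTree

variable {n : ℕ}

/-- Isomorphism of rooted trees: a bijection of the vertices that respects the edges (it respects
the root, the only vertex without outgoing edge). -/
instance setoid (n : ℕ) : Setoid (LabeledRootedTree n) where
  r s t := Nonempty (s.Edge ≃r t.Edge)
  iseqv := ⟨fun t => ⟨RelIso.refl t.Edge⟩, fun ⟨f⟩ => ⟨f.symm⟩, fun ⟨f⟩ ⟨g⟩ => ⟨f.trans g⟩⟩

/-- The order of the group of symmetries of `t`. -/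
def symCard (t : LabeledRootedTree n) : ℕ :=
  Nat.card (t.Edge ≃r t.Edge)

theorem exists_edge (t : LabeledRootedTree n) (k : Fin n) (hk : k ≠ t.root) : ∃ w, t.Edge k w := by
  obtain ⟨w, hadj, hd⟩ : ∃ w, (SimpleGraph.fromRel t.Edge).Adj k w ∧
      (SimpleGraph.fromRel t.Edge).dist w t.root < (SimpleGraph.fromRel t.Edge).dist k t.root := by
    obtain ⟨p, hp⟩ := t.isTree.2.1.exists_walk_length_eq_dist k t.root
    cases p with
    | nil => exact absurd rfl hk
    | cons h q =>
      refine ⟨_, h, ?_⟩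
      have := SimpleGraph.dist_le q
      simp only [SimpleGraph.Walk.length_cons] at hp
      omega
  rcases ((SimpleGraph.fromRel_adj _ _ _).1 hadj).2 with h | h
  · exact ⟨w, h⟩
  · exact absurd (t.toward_root _ _ h) (by omega)

/-- The parent of a vertex other than the root. -/
def parent (t : LabeledRootedTree n) (k : Fin n) (hk : k ≠ t.root) : Fin n :=
  (t.exists_edge k hk).choose

theorem edge_parent (t : LabeledRootedTree n) (k : Fin n) (hk : k ≠ t.root) :
    t.Edge k (t.parent k hk) :=
  (t.exists_edge k hk).choose_spec

theorem parent_ne (t : LabeledRootedTree n) (k : Fin n) (hk : k ≠ t.root) : t.parent k hk ≠ k := by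
  intro h
  have h1 := t.edge_parent k hk
  rw [h] at h1
  exact t.isTree.1 k k h1 h1

open Classical in
/-- The Kontsevich tree `Γ_t`: its interior is `t`, the first edge of every vertex lands on the
first terrestrial vertex, and the second edge of the root lands on the second one. -/
def toKontsevichGraph (t : LabeledRootedTree n) : KontsevichGraph n 2 :=
  ⟨fun k j =>
    if j = 0 then Sum.inr 0
    else if hk : k = t.root then Sum.inr 1
    else Sum.inl (t.parent k hk), by
    intro k
    constructor
    · intro j
      by_cases hj : j = 0 <;> by_cases hk : k = t.root <;> simp [hj, hk, parent_ne]
    · by_cases hk : k = t.root <;> simp [hk]⟩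

theorem wellFounded_edge (t : LabeledRootedTree n) : WellFounded t.Edge := by
  let r : Fin n → Fin n → Prop := fun w v =>
    (SimpleGraph.fromRel t.Edge).dist v t.root < (SimpleGraph.fromRel t.Edge).dist w t.root
  have : IsTrans (Fin n) r := ⟨fun _ _ _ h1 h2 => lt_trans h2 h1⟩
  have : Std.Irrefl r := ⟨fun _ h => lt_irrefl _ h⟩
  exact Subrelation.wf (fun {w v} h => t.toward_root w v h)
    (Finite.wellFounded_of_trans_of_irrefl r)

open Classical in
/-- The elementary differential `D_s^u X` of the vector field `X`, where `s` is the subtree of `t`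
formed by the vertex `v` and its descendants. If the children of `v` are `w_1, …, w_m`, then
`s = [s_1, …, s_m]` for the subtrees `s_k` at `w_k`, and
`D_s^u X = ∑ ∂_{i_1} ⋯ ∂_{i_m} X^u · D_{s_1}^{i_1} X ⋯ D_{s_m}^{i_m} X`. -/
def elemDiffAt {d : ℕ} (t : LabeledRootedTree n) (X : (Fin d → ℝ) → Fin d → ℝ) (v : Fin n)
    (u : Fin d) (x : Fin d → ℝ) : ℝ :=
  ∑ i : {w // t.Edge w v} → Fin d,
    iterPartialDeriv ((Finset.univ : Finset {w // t.Edge w v}).toList.map i) (fun y => X y u) x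
      * ∏ w : {w // t.Edge w v}, t.elemDiffAt X w.1 (i w) x
termination_by t.wellFounded_edge.wrap v
decreasing_by exact w.2

/-- The elementary differential `D_t^u X`. -/
def elemDiff {d : ℕ} (t : LabeledRootedTree n) (X : (Fin d → ℝ) → Fin d → ℝ) (u : Fin d)
    (x : Fin d → ℝ) : ℝ :=
  t.elemDiffAt X t.root u x

end LabeledRootedTree

/-- The set `[RT]` of topological rooted trees, i.e. isomorphism classes of rooted trees; the first
component of `T` is its number `|T|` of vertices. -/
def TopRootedTree : Type :=
  Σ n : ℕ, Quotient (LabeledRootedTree.setoid n)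

/-- The degree `|T|`, the number of vertices. -/
def TopRootedTree.degree (T : TopRootedTree) : ℕ := T.1

/-- `t` is a representative of the topological rooted tree `T`. -/
def TopRootedTree.IsRep (T : TopRootedTree) (t : LabeledRootedTree T.degree) : Prop :=
  Quotient.mk (LabeledRootedTree.setoid T.1) t = T.2

end

/-! ### Iterated partial derivatives -/

section Calculus

variable {d : ℕ}

/-! Compare coefficients of ε^n; for n = 0 both sides give x^i. Let n ≥ 1. The symbol of Γ is
homogeneous in p_2, of degree the number of edges landing on the second terrestrial vertex, so
differentiation at p_2 = 0 keeps only the trees with exactly one such edge (`symbolDeriv_eq_zero`).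
Of the 2n edges of such a tree, n - 1 are aerial, so n land on the first terrestrial vertex. Edges
leaving the same vertex have distinct targets, so each vertex sends exactly one edge there
(`exists_target_eq_zero`). The remaining edges form a labeled rooted tree t, and Γ is Γ_t up to the
order of the two edges at each vertex.

Exchanging the two edges at a vertex changes the sign of the weight (two rows of a determinant) and
of the symbol (antisymmetry of π), so the product is unchanged. The 2^n orderings therefore cancel
the factor (1/2)^n coming from π/2 (`sum_weight_mul_symbolDeriv`). For Γ_t itself, summing over the
indices of the first edges contracts π with p at each vertex, which leaves the elementary
differential of L_V (`symbolDeriv_toKontsevichGraph`).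

The coefficient is thus 1/n! times the sum of W_t D_t L_V over labeled rooted trees. The summand is
invariant under isomorphism, and by orbit counting the class of t has n!/|sym t| members, which
gives the factor 1/|sym t|. -/

theorem ContDiff.partialDeriv {f : (Fin d → ℝ) → ℝ} (hf : ContDiff ℝ ∞ f) (i : Fin d) :
    ContDiff ℝ ∞ (partialDeriv i f) := by
  unfold _root_.partialDeriv
  exact (hf.fderiv_right (m := ∞) (by simp)).clm_apply contDiff_const

theorem ContDiff.iterPartialDeriv {f : (Fin d → ℝ) → ℝ} (hf : ContDiff ℝ ∞ f)
    (l : List (Fin d)) : ContDiff ℝ ∞ (iterPartialDeriv l f) := by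
  induction l with
  | nil => exact hf
  | cons i l ih => exact ih.partialDeriv i

theorem iterPartialDeriv_cons (i : Fin d) (l : List (Fin d)) (f : (Fin d → ℝ) → ℝ) :
    iterPartialDeriv (i :: l) f = partialDeriv i (iterPartialDeriv l f) := rfl

theorem partialDeriv_comm {f : (Fin d → ℝ) → ℝ} (hf : ContDiff ℝ ∞ f) (i j : Fin d) :
    partialDeriv i (partialDeriv j f) = partialDeriv j (partialDeriv i f) := by
  have hd : Differentiable ℝ (fderiv ℝ f) :=
    (hf.fderiv_right (m := ∞) (by simp)).differentiable (by simp)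
  have key : ∀ (a b : Fin d) (x : Fin d → ℝ), partialDeriv a (partialDeriv b f) x
      = fderiv ℝ (fderiv ℝ f) x (Pi.single a 1) (Pi.single b 1) := by
    intro a b x
    unfold partialDeriv
    rw [fderiv_clm_apply (hd x) (differentiableAt_const _)]
    simp
  funext x
  rw [key, key]
  exact (hf.contDiffAt.isSymmSndFDerivAt
    (by rw [minSmoothness_of_isRCLikeNormedField]; exact WithTop.coe_le_coe.2 le_top)).eq _ _

/-- Lists of incoming edges come from `Finset.toList` in no particular order, so lists for related
graphs agree only up to permutation. -/
theorem iterPartialDeriv_perm {f : (Fin d → ℝ) → ℝ} (hf : ContDiff ℝ ∞ f) {l l' : List (Fin d)}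
    (h : l.Perm l') : iterPartialDeriv l f = iterPartialDeriv l' f := by
  induction h with
  | nil => rfl
  | cons a _ ih => rw [iterPartialDeriv_cons, iterPartialDeriv_cons, ih]
  | swap a b l =>
    simp only [iterPartialDeriv_cons]
    exact partialDeriv_comm (hf.iterPartialDeriv l) b a
  | trans _ _ ih₁ ih₂ => exact ih₁.trans ih₂

theorem partialDeriv_const_mul {f : (Fin d → ℝ) → ℝ} (hf : ContDiff ℝ ∞ f) (c : ℝ) (i : Fin d) :
    partialDeriv i (fun y => c * f y) = fun y => c * partialDeriv i f y := by
  funext x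
  have hfx : DifferentiableAt ℝ f x := (hf.differentiable (by simp)) x
  simp only [partialDeriv]
  rw [fderiv_const_mul hfx]
  simp

theorem iterPartialDeriv_const_mul {f : (Fin d → ℝ) → ℝ} (hf : ContDiff ℝ ∞ f) (c : ℝ)
    (l : List (Fin d)) :
    iterPartialDeriv l (fun y => c * f y) = fun y => c * iterPartialDeriv l f y := by
  induction l with
  | nil => rfl
  | cons i l ih =>
    rw [iterPartialDeriv_cons, ih, partialDeriv_const_mul (hf.iterPartialDeriv l) c i]
    rfl

theorem partialDeriv_sum {ι : Type*} (s : Finset ι) {f : ι → (Fin d → ℝ) → ℝ}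
    (hf : ∀ a, ContDiff ℝ ∞ (f a)) (i : Fin d) :
    partialDeriv i (fun y => ∑ a ∈ s, f a y) = fun y => ∑ a ∈ s, partialDeriv i (f a) y := by
  funext x
  simp only [partialDeriv]
  rw [fderiv_fun_sum fun a _ => ((hf a).differentiable (by simp)) x]
  simp

theorem iterPartialDeriv_sum {ι : Type*} (s : Finset ι) {f : ι → (Fin d → ℝ) → ℝ}
    (hf : ∀ a, ContDiff ℝ ∞ (f a)) (l : List (Fin d)) :
    iterPartialDeriv l (fun y => ∑ a ∈ s, f a y)
      = fun y => ∑ a ∈ s, iterPartialDeriv l (f a) y := by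
  induction l with
  | nil => rfl
  | cons i l ih =>
    rw [iterPartialDeriv_cons, ih, partialDeriv_sum s (fun a => (hf a).iterPartialDeriv l) i]
    rfl

theorem contDiff_exp_dotProduct (p : Fin d → ℝ) :
    ContDiff ℝ ∞ fun y : Fin d → ℝ => Real.exp (p ⬝ᵥ y) := by
  unfold dotProduct
  fun_prop

theorem iterPartialDeriv_exp (p : Fin d → ℝ) (l : List (Fin d)) :
    iterPartialDeriv l (fun y => Real.exp (p ⬝ᵥ y))
      = fun y => (l.map p).prod * Real.exp (p ⬝ᵥ y) := by
  induction l with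
  | nil => simp [iterPartialDeriv]
  | cons i l ih =>
    rw [iterPartialDeriv_cons, ih, partialDeriv_const_mul (contDiff_exp_dotProduct p)]
    funext x
    have hd : HasFDerivAt (fun y : Fin d → ℝ => p ⬝ᵥ y)
        (∑ j, p j • (ContinuousLinearMap.proj j : (Fin d → ℝ) →L[ℝ] ℝ)) x := by
      unfold dotProduct
      exact HasFDerivAt.fun_sum fun j _ => (hasFDerivAt_apply j x).const_mul (p j)
    simp only [partialDeriv]
    rw [hd.exp.fderiv]
    simp [Pi.single_apply]
    ring

/-- The coefficient of `∂/∂q_i` at `q = 0` of the monomial `∏_{j ∈ l} q_j`. -/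
def linearCoeff (i : Fin d) (l : List (Fin d)) : ℝ :=
  if l = [i] then 1 else 0

/-- A monomial of degree 0 is constant, and one of degree at least 2 has zero derivative at the
origin, since each term of the product rule retains a vanishing factor. -/
theorem hasFDerivAt_prod_map (l : List (Fin d)) :
    ∃ L : (Fin d → ℝ) →L[ℝ] ℝ, HasFDerivAt (fun q : Fin d → ℝ => (l.map q).prod) L 0 ∧
      ∀ i, L (Pi.single i 1) = linearCoeff i l := by
  match l with
  | [] => exact ⟨0, by simpa using hasFDerivAt_const _ _, fun i => by simp [linearCoeff]⟩
  | [a] =>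
    refine ⟨ContinuousLinearMap.proj a, by simpa using hasFDerivAt_apply a _, fun i => ?_⟩
    simp [linearCoeff, Pi.single_apply]
  | a :: b :: l =>
    obtain ⟨L, hL, -⟩ := hasFDerivAt_prod_map (b :: l)
    refine ⟨_, (hasFDerivAt_apply (𝕜 := ℝ) a (0 : Fin d → ℝ)).fun_mul hL, fun i => ?_⟩
    simp [linearCoeff]

end Calculus

/-! ### Symmetries of Kontsevich graphs and their weights -/

namespace KontsevichGraph

variable {n m : ℕ}

@[ext]
theorem ext {Γ Γ' : KontsevichGraph n m} (h : ∀ k j, Γ.1 k j = Γ'.1 k j) : Γ = Γ' :=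
  Subtype.ext (funext fun k => funext fun j => h k j)

theorem target_injective (Γ : KontsevichGraph n m) (k : Fin n) : Function.Injective (Γ.1 k) := by
  intro a b h
  have h0 := (Γ.2 k).2
  fin_cases a <;> fin_cases b <;> first | rfl | exact absurd h h0 | exact absurd h.symm h0

/-- The graph obtained from `Γ` by permuting the two edges leaving each aerial vertex. -/
def flip (s : Fin n → Equiv.Perm (Fin 2)) (Γ : KontsevichGraph n m) : KontsevichGraph n m :=
  ⟨fun k j => Γ.1 k (s k j), fun k => ⟨fun _ => (Γ.2 k).1 _, fun h => by
    simpa using Γ.target_injective k h⟩⟩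

theorem flip_target (s : Fin n → Equiv.Perm (Fin 2)) (Γ : KontsevichGraph n m) (e : Fin n × Fin 2) :
    (flip s Γ).target e = Γ.target (Equiv.prodCongrRight s e) := rfl

theorem flip_interior (s : Fin n → Equiv.Perm (Fin 2)) (Γ : KontsevichGraph n m) :
    (flip s Γ).interior = Γ.interior := by
  funext k l
  refine propext ⟨fun ⟨j, hj⟩ => ⟨s k j, hj⟩, fun ⟨j, hj⟩ => ⟨(s k).symm j, ?_⟩⟩
  rw [flip_target]
  simpa using hj

theorem mem_incoming {Γ : KontsevichGraph n m} {v : Fin n ⊕ Fin m} {e : Fin n × Fin 2} :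
    e ∈ Γ.incoming v ↔ Γ.target e = v := by
  simp [incoming]

theorem nodup_incoming (Γ : KontsevichGraph n m) (v : Fin n ⊕ Fin m) : (Γ.incoming v).Nodup :=
  Finset.nodup_toList _

theorem flip_incoming (s : Fin n → Equiv.Perm (Fin 2)) (Γ : KontsevichGraph n m)
    (v : Fin n ⊕ Fin m) :
    (((flip s Γ).incoming v).map (Equiv.prodCongrRight s)).Perm (Γ.incoming v) := by
  rw [List.perm_ext_iff_of_nodup ((nodup_incoming _ _).map (Equiv.injective _))
    (nodup_incoming _ _)]
  intro e
  simp only [List.mem_map, mem_incoming, flip_target]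
  exact ⟨by rintro ⟨a, h, rfl⟩; exact h,
    fun h => ⟨(Equiv.prodCongrRight s).symm e, by rwa [Equiv.apply_symm_apply],
      Equiv.apply_symm_apply _ _⟩⟩

/-- The flip permutes the rows of the determinant within the pair belonging to each vertex, so its
sign is the product of the local signs. -/
theorem weight_flip (s : Fin n → Equiv.Perm (Fin 2)) (Γ : KontsevichGraph n 2) :
    (flip s Γ).weight = (∏ k, ((Equiv.Perm.sign (s k) : ℤ) : ℝ)) * Γ.weight := by
  unfold weight
  rw [← MeasureTheory.integral_const_mul]
  congr 1
  funext z
  have h := Matrix.det_permute (Equiv.prodCongrRight s)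
    (Matrix.of fun e b : Fin n × Fin 2 => fderiv ℝ (Γ.edgeAngle e) z (coordVector b))
  rw [Equiv.Perm.sign_prodCongrRight] at h
  push_cast at h
  exact h

/-- Relabeling the aerial vertices does not change the weight. -/
theorem weight_eq_of_relabel (σ : Equiv.Perm (Fin n)) {Γ Γ' : KontsevichGraph n 2}
    (h : ∀ k j, Γ'.1 (σ k) j = Sum.map σ id (Γ.1 k j)) : Γ'.weight = Γ.weight := by
  let L : (Fin n → ℂ) ≃L[ℝ] (Fin n → ℂ) := ContinuousLinearEquiv.piCongrLeft ℝ (fun _ => ℂ) σ.symm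
  have hL : ∀ z k, L z k = z (σ k) := by
    intro z k
    obtain ⟨l, rfl⟩ := σ.symm.surjective k
    rw [Equiv.apply_symm_apply]
    exact Equiv.piCongrLeft_apply_apply (fun _ : Fin n => ℂ) σ.symm z l
  have hedge : ∀ e : Fin n × Fin 2, Γ'.edgeAngle (σ e.1, e.2) = Γ.edgeAngle e ∘ L := by
    rintro ⟨k, j⟩
    funext z
    simp only [edgeAngle, Function.comp, hL, target, h]
    congr 1
    cases Γ.1 k j <;> simp [position, hL]
  have hcoord : ∀ b : Fin n × Fin 2, L (coordVector (σ b.1, b.2)) = coordVector b := by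
    rintro ⟨l, c⟩
    funext k
    simp [hL, coordVector, Pi.single_apply]
  have hform : ∀ z, Γ'.angleForm z = Γ.angleForm (L z) := by
    intro z
    unfold angleForm
    -- Rows and columns are reindexed by the same permutation, so no sign appears: relabeling moves
    -- whole pairs dx ∧ dy.
    rw [← Matrix.det_submatrix_equiv_self (Equiv.prodCongr σ (Equiv.refl (Fin 2)))]
    congr 1
    ext e b
    have h1 := hedge e
    simp only [Matrix.submatrix_apply, Matrix.of_apply, Equiv.prodCongr_apply, Prod.map,
      Equiv.refl_apply, h1]
    rw [L.comp_right_fderiv, ← hcoord b]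
    rfl
  have hmp : MeasureTheory.MeasurePreserving L :=
    MeasureTheory.volume_measurePreserving_piCongrLeft (fun _ : Fin n => ℂ) σ.symm
  have hpre : L ⁻¹' configurations n = configurations n := by
    ext z
    have hz : L z = z ∘ σ := funext (hL z)
    simp only [configurations, Set.mem_preimage, Set.mem_ofPred_eq, hL]
    rw [hz, σ.injective_comp]
    exact and_congr_left fun _ => σ.forall_congr_right (q := fun k => 0 < (z k).im)
  unfold weight
  simp only [hform]
  have := hmp.setIntegral_preimage_emb L.toHomeomorph.measurableEmbedding Γ.angleForm
    (configurations n)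
  rwa [hpre] at this

end KontsevichGraph

/-! ### Rooted trees -/

namespace LabeledRootedTree

variable {n : ℕ}

theorem Edge.adj {t : LabeledRootedTree n} {v w : Fin n} (h : t.Edge v w) :
    (SimpleGraph.fromRel t.Edge).Adj v w :=
  (SimpleGraph.fromRel_adj _ _ _).2 ⟨fun e => t.isTree.1 v w h (e ▸ e ▸ h), Or.inl h⟩

theorem not_edge_root (t : LabeledRootedTree n) (w : Fin n) : ¬ t.Edge t.root w := fun h => by
  simpa using t.toward_root _ _ h

/-- Prepending v to a shortest path from w to the root gives a path, because v is farther from the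
root than w. Paths in a tree are unique, so the second vertex is determined. -/
theorem edge_unique {t : LabeledRootedTree n} {v w w' : Fin n} (h : t.Edge v w)
    (h' : t.Edge v w') : w = w' := by
  have key : ∀ {w}, t.Edge v w →
      ∃ p : (SimpleGraph.fromRel t.Edge).Walk v t.root, p.IsPath ∧ p.snd = w := by
    intro w h
    obtain ⟨q, hq, hlen⟩ := t.isTree.2.1.exists_path_of_dist w t.root
    refine ⟨.cons h.adj q, hq.cons fun hv => ?_, by simp⟩
    have h1 := SimpleGraph.dist_le (q.dropUntil v hv)
    have h2 := q.length_dropUntil_le_length hv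
    have h3 := t.toward_root _ _ h
    omega
  obtain ⟨p, hp, rfl⟩ := key h
  obtain ⟨q, hq, rfl⟩ := key h'
  rw [(t.isTree.2.existsUnique_path v t.root).unique hp hq]

theorem eq_root_iff (t : LabeledRootedTree n) (v : Fin n) : v = t.root ↔ ∀ w, ¬ t.Edge v w := by
  refine ⟨fun h w => h ▸ t.not_edge_root w, fun h => ?_⟩
  by_contra hv
  obtain ⟨w, hw⟩ := t.exists_edge v hv
  exact h w hw

@[ext]
-- The root is recovered from the edges as the only vertex without an outgoing edge.
theorem ext {s t : LabeledRootedTree n} (h : s.Edge = t.Edge) : s = t := by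
  have hr : s.root = t.root := by rw [t.eq_root_iff, ← h, ← s.eq_root_iff]
  cases s; cases t
  congr

noncomputable instance : Fintype (LabeledRootedTree n) :=
  @Fintype.ofFinite _ (Finite.of_injective Edge fun _ _ => ext)

theorem edge_iff_parent (t : LabeledRootedTree n) {k : Fin n} (hk : k ≠ t.root) (w : Fin n) :
    t.Edge k w ↔ t.parent k hk = w :=
  ⟨fun h => edge_unique (t.edge_parent k hk) h, fun h => h ▸ t.edge_parent k hk⟩

theorem dist_le_of_reflTransGen {t : LabeledRootedTree n} {k v : Fin n}
    (h : Relation.ReflTransGen t.Edge k v) :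
    (SimpleGraph.fromRel t.Edge).dist v t.root ≤ (SimpleGraph.fromRel t.Edge).dist k t.root := by
  induction h with
  | refl => exact le_rfl
  | tail _ h ih => exact (t.toward_root _ _ h).le.trans ih

theorem reflTransGen_root (t : LabeledRootedTree n) (k : Fin n) :
    Relation.ReflTransGen t.Edge k t.root := by
  induction k using (InvImage.wf (fun k => (SimpleGraph.fromRel t.Edge).dist k t.root)
    Nat.lt_wfRel.wf).induction with
  | _ k ih =>
    by_cases hk : k = t.root
    · rw [hk]
    · obtain ⟨w, hw⟩ := t.exists_edge k hk
      exact (ih w (t.toward_root _ _ hw)).head hw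

/-- The vertices of the subtree of `t` at `v`. -/
abbrev Descendants (t : LabeledRootedTree n) (v : Fin n) : Type :=
  {k // Relation.ReflTransGen t.Edge k v}

noncomputable instance (t : LabeledRootedTree n) (v : Fin n) : Fintype (t.Descendants v) :=
  Fintype.ofFinite _

noncomputable instance (t : LabeledRootedTree n) (v : Fin n) : Fintype {w // t.Edge w v} :=
  Fintype.ofFinite _

/-- The subtree at `v` consists of `v` and of the subtrees at the children of `v`. -/
noncomputable def descendantsEquiv (t : LabeledRootedTree n) (v : Fin n) :
    (Option (Σ w : {w // t.Edge w v}, t.Descendants w.1)) ≃ t.Descendants v :=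
  Equiv.ofBijective
    (fun o => o.elim ⟨v, .refl⟩ fun a => ⟨a.2.1, a.2.2.tail a.1.2⟩) <| by
    have hne : ∀ (w : {w // t.Edge w v}) (k : t.Descendants w.1), k.1 ≠ v := by
      intro w k h
      have h1 := dist_le_of_reflTransGen k.2
      have h2 := t.toward_root _ _ w.2
      rw [h] at h1
      omega
    constructor
    -- Distinct children of v are incomparable: a nontrivial chain from w to w' passes through v,
    -- the only parent of w, but w' is farther from the root than v. Hence the subtrees at the
    -- children are disjoint, since any two ancestors of one vertex are comparable.
    · have hsub : ∀ w w' : {w // t.Edge w v}, Relation.ReflTransGen t.Edge w.1 w'.1 → w = w' := by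
        intro w w' h
        rcases h.cases_head with h | ⟨c, hc, h⟩
        · exact Subtype.ext h
        · have h1 := dist_le_of_reflTransGen h
          rw [edge_unique hc w.2] at h1
          exact absurd (t.toward_root _ _ w'.2) (by omega)
      rintro (_ | ⟨w, k⟩) (_ | ⟨w', k'⟩) h
      · rfl
      · exact absurd (congrArg Subtype.val h).symm (hne w' k')
      · exact absurd (congrArg Subtype.val h) (hne w k)
      · have hk : k.1 = k'.1 := congrArg Subtype.val h
        obtain rfl : w = w' := by
          rcases Relation.ReflTransGen.total_of_right_unique (r := t.Edge)
            (fun _ _ _ h h' => edge_unique h h') k.2 (hk ▸ k'.2) with h | h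
          · exact hsub _ _ h
          · exact (hsub _ _ h).symm
        obtain rfl : k = k' := Subtype.ext hk
        rfl
    · rintro ⟨k, hk⟩
      rcases hk.cases_tail with rfl | ⟨w, hkw, hw⟩
      · exact ⟨none, rfl⟩
      · exact ⟨some ⟨⟨w, hw⟩, ⟨k, hkw⟩⟩, rfl⟩

/-- The list of the children of `v`. -/
noncomputable def children (t : LabeledRootedTree n) (v : Fin n) : List {w // t.Edge w v} :=
  Finset.univ.toList

theorem elemDiffAt_eq_sum {d : ℕ} (t : LabeledRootedTree n) (X : (Fin d → ℝ) → Fin d → ℝ)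
    (v : Fin n) (u : Fin d) (x : Fin d → ℝ) :
    t.elemDiffAt X v u x = ∑ i : {w // t.Edge w v} → Fin d,
      iterPartialDeriv ((t.children v).map i) (fun y => X y u) x
        * ∏ w : {w // t.Edge w v}, t.elemDiffAt X w.1 (i w) x := by
  rw [elemDiffAt]
  unfold children
  -- The two sides differ only in instances on the set of children.
  convert rfl

end LabeledRootedTree

/-! ### Elementary differentials as sums over vertex labelings, and isomorphism invariance -/

namespace LabeledRootedTree

variable {n d : ℕ}

/-- Labelings of the subtree at `v` are labelings of `v` and of the subtrees at its children. -/
noncomputable def labelingEquiv (t : LabeledRootedTree n) (v : Fin n) (α : Type*) :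
    α × ((w : {w // t.Edge w v}) → t.Descendants w.1 → α) ≃ (t.Descendants v → α) :=
  ((Equiv.piOptionEquivProd (β := fun _ => α)).trans
    (Equiv.prodCongr (Equiv.refl α) (Equiv.piCurry fun _ _ => α))).symm.trans
    (Equiv.arrowCongr (t.descendantsEquiv v) (Equiv.refl α))

theorem labelingEquiv_apply_self (t : LabeledRootedTree n) (v : Fin n) {α : Type*} (c : α)
    (b : (w : {w // t.Edge w v}) → t.Descendants w.1 → α) (h) :
    t.labelingEquiv v α (c, b) ⟨v, h⟩ = c := by
  have h1 : (⟨v, h⟩ : t.Descendants v) = t.descendantsEquiv v none := rfl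
  simp only [labelingEquiv, h1, Equiv.trans_apply, Equiv.arrowCongr_apply, Function.comp_apply,
    Equiv.symm_apply_apply]
  rfl

theorem labelingEquiv_apply_child (t : LabeledRootedTree n) (v : Fin n) {α : Type*} (c : α)
    (b : (w : {w // t.Edge w v}) → t.Descendants w.1 → α) (w : {w // t.Edge w v})
    (k : t.Descendants w.1) (h) :
    t.labelingEquiv v α (c, b) ⟨k.1, h⟩ = b w k := by
  have h1 : (⟨k.1, h⟩ : t.Descendants v) = t.descendantsEquiv v (some ⟨w, k⟩) := rfl
  simp only [labelingEquiv, h1, Equiv.trans_apply, Equiv.arrowCongr_apply, Function.comp_apply,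
    Equiv.symm_apply_apply]
  rfl

open Classical in
-- This unwinds the recursion: the summation index attached to a child becomes the label of that
-- child, and the labelings of the child subtrees together with the label of v form one labeling.
-- The non-recursive form matches the sum over index assignments in the Kontsevich operator.
theorem elemDiffAt_eq_sum_labelings (t : LabeledRootedTree n) (X : (Fin d → ℝ) → Fin d → ℝ)
    (v : Fin n) (u : Fin d) (x : Fin d → ℝ) :
    t.elemDiffAt X v u x = ∑ b : t.Descendants v → Fin d,
      if b ⟨v, .refl⟩ = u then
        ∏ k : t.Descendants v, iterPartialDeriv
          ((t.children k.1).map fun w => b ⟨w.1, k.2.head w.2⟩) (fun y => X y (b k)) x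
      else 0 := by
  induction v using t.wellFounded_edge.induction generalizing u with
  | _ v ih =>
    rw [elemDiffAt_eq_sum]
    simp only [fun (i : {w // t.Edge w v} → Fin d) (w : {w // t.Edge w v}) => ih w.1 w.2 (i w),
      Finset.prod_univ_sum, Fintype.piFinset_univ, Finset.prod_ite_zero, Finset.mem_univ,
      true_implies, Finset.mul_sum]
    rw [Finset.sum_comm, ← (t.labelingEquiv v (Fin d)).sum_comp, Fintype.sum_prod_type_right]
    refine Finset.sum_congr rfl fun b _ => ?_
    -- The conditions force the index at each child to be the label of that child, and the label of
    -- v to be u.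
    rw [Finset.sum_eq_single (fun w => b w ⟨w.1, .refl⟩), Finset.sum_eq_single u]
    · rw [if_pos fun _ => rfl, if_pos (labelingEquiv_apply_self ..),
        ← (t.descendantsEquiv v).prod_comp, Fintype.prod_option, Fintype.prod_sigma]
      congr 1
      · exact (congrArg₂ (fun l f => iterPartialDeriv l f x)
          (List.map_congr_left fun w _ => labelingEquiv_apply_child t v u b w ⟨w.1, .refl⟩ _)
          (funext fun y => congrArg (X y) (labelingEquiv_apply_self t v u b _))).symm
      · exact Finset.prod_congr rfl fun w _ => Finset.prod_congr rfl fun k _ =>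
          (congrArg₂ (fun l f => iterPartialDeriv l f x)
            (List.map_congr_left fun w' _ =>
              labelingEquiv_apply_child t v u b w ⟨w'.1, k.2.head w'.2⟩ _)
            (funext fun y => congrArg (X y) (labelingEquiv_apply_child t v u b w k _))).symm
    · intro c _ hc
      rw [if_neg (by rwa [labelingEquiv_apply_self])]
    · simp
    · intro i _ hi
      rw [if_neg, mul_zero]
      exact fun h => hi (funext fun w => (h w).symm)
    · simp

/-- The list of the children of `v`, as vertices of `t`. -/
noncomputable def childList (t : LabeledRootedTree n) (v : Fin n) : List (Fin n) :=
  (t.children v).map Subtype.val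

theorem mem_childList {t : LabeledRootedTree n} {v w : Fin n} :
    w ∈ t.childList v ↔ t.Edge w v := by
  simp [childList, children]

theorem nodup_childList (t : LabeledRootedTree n) (v : Fin n) : (t.childList v).Nodup :=
  (Finset.nodup_toList _).map Subtype.val_injective

open Classical in
/-- The elementary differential as a single sum over all labelings of the vertices. -/
theorem elemDiff_eq_sum (t : LabeledRootedTree n) (X : (Fin d → ℝ) → Fin d → ℝ)
    (u : Fin d) (x : Fin d → ℝ) :
    t.elemDiff X u x = ∑ b : Fin n → Fin d, if b t.root = u then
      ∏ k, iterPartialDeriv ((t.childList k).map b) (fun y => X y (b k)) x else 0 := by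
  rw [elemDiff, elemDiffAt_eq_sum_labelings]
  let e : t.Descendants t.root ≃ Fin n := Equiv.subtypeUnivEquiv t.reflTransGen_root
  refine Fintype.sum_equiv (Equiv.arrowCongr e (Equiv.refl _)) _ _ fun b => ?_
  refine if_congr Iff.rfl ?_ rfl
  refine Fintype.prod_equiv e _ _ fun k => ?_
  simp only [childList, List.map_map]
  rfl

theorem apply_root {s t : LabeledRootedTree n} (f : s.Edge ≃r t.Edge) : f s.root = t.root := by
  rw [t.eq_root_iff]
  intro w hw
  obtain ⟨w, rfl⟩ := f.surjective w
  exact s.not_edge_root _ (f.map_rel_iff.1 hw)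

theorem elemDiff_congr {s t : LabeledRootedTree n} (f : s.Edge ≃r t.Edge)
    {X : (Fin d → ℝ) → Fin d → ℝ} (hX : ∀ u, ContDiff ℝ ∞ fun y => X y u) (u : Fin d)
    (x : Fin d → ℝ) : s.elemDiff X u x = t.elemDiff X u x := by
  classical
  rw [elemDiff_eq_sum, elemDiff_eq_sum]
  refine Fintype.sum_equiv (Equiv.arrowCongr f.toEquiv (Equiv.refl _)) _ _ fun b => ?_
  have hb : ∀ k, Equiv.arrowCongr f.toEquiv (Equiv.refl (Fin d)) b (f k) = b k := fun k =>
    congrArg b (f.symm_apply_apply k)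
  rw [← apply_root f, hb]
  refine if_congr Iff.rfl ?_ rfl
  refine Fintype.prod_equiv f.toEquiv _ _ fun k => ?_
  change _ = iterPartialDeriv _ (fun y => X y (Equiv.arrowCongr f.toEquiv _ b (f k))) x
  rw [hb]
  refine congrFun (iterPartialDeriv_perm (hX _) ?_) x
  have h1 : ((s.childList k).map f).Perm (t.childList (f k)) := by
    rw [List.perm_ext_iff_of_nodup ((nodup_childList _ _).map f.injective) (nodup_childList _ _)]
    intro w
    obtain ⟨w, rfl⟩ := f.surjective w
    simp [mem_childList, f.map_rel_iff]
  have h2 := h1.map (Equiv.arrowCongr f.toEquiv (Equiv.refl (Fin d)) b)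
  rw [List.map_map, show _ ∘ f = b from funext hb] at h2
  exact h2

theorem weight_congr {s t : LabeledRootedTree n} (f : s.Edge ≃r t.Edge) :
    s.toKontsevichGraph.weight = t.toKontsevichGraph.weight := by
  refine (KontsevichGraph.weight_eq_of_relabel f.toEquiv fun k j => ?_).symm
  change t.toKontsevichGraph.1 (f k) j = _
  simp only [toKontsevichGraph, ← apply_root f]
  by_cases hj : j = 0
  · simp [hj]
  · by_cases hk : k = s.root
    · simp [hj, hk]
    · have hk' : f k ≠ t.root := by rw [← apply_root f]; simpa using hk
      have hp : t.parent (f k) hk' = f (s.parent k hk) :=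
        (t.edge_iff_parent hk' _).1 (f.map_rel_iff.2 (s.edge_parent k hk))
      simp [hj, hk, hp]

/-- In a tree in which at most one edge leaves each vertex, and none the root, all edges are
oriented towards the root. -/
theorem toward_root_of_unique {E : Fin n → Fin n → Prop} (hE : (SimpleGraph.fromRel E).Connected)
    {r : Fin n} (hr : ∀ w, ¬ E r w) (hu : ∀ v w w', E v w → E v w' → w = w') {v w : Fin n}
    (h : E v w) : (SimpleGraph.fromRel E).dist w r < (SimpleGraph.fromRel E).dist v r := by
  -- Each vertex at distance m + 1 from r has an outgoing edge to distance m. If a shortest path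
  -- from v began with an edge a → v against the orientation, then by induction the only edge
  -- leaving a would end closer to r than a, whereas v is farther away.
  have key : ∀ m v, (SimpleGraph.fromRel E).dist v r = m + 1 →
      ∃ w, E v w ∧ (SimpleGraph.fromRel E).dist w r = m := by
    intro m
    induction m with
    | zero =>
      intro v hv
      rcases ((SimpleGraph.fromRel_adj _ _ _).1 (SimpleGraph.dist_eq_one_iff_adj.1 hv)).2 with h | h
      · exact ⟨r, h, by simp⟩
      · exact absurd h (hr v)
    | succ m ih =>
      intro v hv
      obtain ⟨p, hp⟩ := hE.exists_walk_length_eq_dist v r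
      cases p with
      | nil => simp at hv
      | cons hadj q =>
        rename_i a
        have h1 := SimpleGraph.dist_le q
        have h2 := hE.dist_triangle (u := v) (v := a) (w := r)
        rw [SimpleGraph.dist_eq_one_iff_adj.2 hadj] at h2
        simp only [SimpleGraph.Walk.length_cons] at hp
        have ha : (SimpleGraph.fromRel E).dist a r = m + 1 := by omega
        rcases ((SimpleGraph.fromRel_adj _ _ _).1 hadj).2 with h | h
        · exact ⟨a, h, ha⟩
        · obtain ⟨c, hc, hcd⟩ := ih a ha
          rw [hu _ _ _ hc h] at hcd
          omega
  have hv : v ≠ r := fun e => hr w (e ▸ h)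
  obtain ⟨m, hm⟩ := Nat.exists_eq_succ_of_ne_zero (hE.pos_dist_of_ne hv).ne'
  obtain ⟨c, hc, hcd⟩ := key m v hm
  rw [hu _ _ _ h hc]
  omega

/-! ### Relabelings and orbit counting -/

/-- The rooted tree obtained by renaming the vertices. -/
def relabel (t : LabeledRootedTree n) (σ : Equiv.Perm (Fin n)) : LabeledRootedTree n where
  Edge v w := t.Edge (σ.symm v) (σ.symm w)
  root := σ t.root
  isTree := by
    refine ⟨fun v w => t.isTree.1 _ _, ?_⟩
    refine (SimpleGraph.Iso.isTree_iff (G := SimpleGraph.fromRel t.Edge) ⟨σ, ?_⟩).1 t.isTree.2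
    simp
  toward_root v w h := by
    refine toward_root_of_unique ?_ (fun w => ?_) (fun v w w' h h' => ?_) h
    · refine (SimpleGraph.Iso.connected_iff (G := SimpleGraph.fromRel t.Edge) ⟨σ, ?_⟩).1
        t.isTree.2.1
      simp
    · simpa using t.not_edge_root _
    · exact σ.symm.injective (edge_unique h h')

/-- The isomorphism of `t` with the tree obtained from it by renaming the vertices. -/
def relabelIso (t : LabeledRootedTree n) (σ : Equiv.Perm (Fin n)) :
    t.Edge ≃r (t.relabel σ).Edge :=
  ⟨σ, by simp [relabel]⟩

/-- A permutation of the vertices is an isomorphism onto some rooted tree. -/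
def permEquivSigmaIso (t : LabeledRootedTree n) :
    Equiv.Perm (Fin n) ≃ Σ s : {s : LabeledRootedTree n // t ≈ s}, (t.Edge ≃r s.1.Edge) where
  toFun σ := ⟨⟨t.relabel σ, ⟨t.relabelIso σ⟩⟩, t.relabelIso σ⟩
  invFun a := a.2.toEquiv
  left_inv _ := rfl
  right_inv := by
    rintro ⟨⟨s, hs⟩, σ, hσ⟩
    obtain rfl : s = t.relabel σ := by
      ext v w
      change _ ↔ t.Edge (σ.symm v) (σ.symm w)
      rw [← hσ]
      simp
    rfl

open Classical in
/-- The orbit formula: `n! = |class of t| · |sym t|`. -/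
theorem card_class_mul_symCard (t : LabeledRootedTree n) :
    (Finset.univ.filter fun s => t ≈ s).card * t.symCard = n.factorial := by
  have h := Nat.card_congr t.permEquivSigmaIso
  have hfin : ∀ s : LabeledRootedTree n, Finite (t.Edge ≃r s.Edge) := fun s =>
    Finite.of_injective RelIso.toEquiv RelIso.toEquiv_injective
  rw [Nat.card_perm, Nat.card_fin, Nat.card_sigma] at h
  -- The n! permutations are sorted by the tree they produce. The isomorphisms from t onto a fixed
  -- tree of its class correspond to automorphisms of t by composition with a chosen isomorphism.
  rw [h, Finset.sum_congr rfl fun s _ => (?_ : _ = t.symCard)]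
  · simp [Fintype.card_subtype]
  · obtain ⟨f⟩ := s.2
    exact Nat.card_congr ⟨fun g => g.trans f.symm, fun g => g.trans f,
      fun g => by ext; simp, fun g => by ext; simp⟩

theorem symCard_ne_zero (t : LabeledRootedTree n) : t.symCard ≠ 0 := by
  intro h
  have := t.card_class_mul_symCard
  rw [h, mul_zero] at this
  exact n.factorial_ne_zero this.symm

open Classical in
/-- Summing an isomorphism invariant over all rooted trees with `n` labeled vertices. -/
theorem sum_eq_sum_quotient (φ : LabeledRootedTree n → ℝ) (hφ : ∀ s t, s ≈ t → φ s = φ t)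
    (rep : Quotient (setoid n) → LabeledRootedTree n) (hrep : ∀ T, ⟦rep T⟧ = T) :
    (1 / (n.factorial : ℝ)) * ∑ t, φ t = ∑ T, φ (rep T) / (rep T).symCard := by
  rw [← Finset.sum_fiberwise Finset.univ (fun t => (⟦t⟧ : Quotient (setoid n))), Finset.mul_sum]
  refine Finset.sum_congr rfl fun T _ => ?_
  have hmem : ∀ t : LabeledRootedTree n, ⟦t⟧ = T ↔ rep T ≈ t := by
    intro t
    conv_lhs => rw [← hrep T]
    rw [Quotient.eq]
    exact ⟨Setoid.symm, Setoid.symm⟩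
  rw [Finset.sum_congr rfl fun t ht => (hφ _ _ ((hmem t).1 (Finset.mem_filter.1 ht).2)).symm,
    Finset.sum_const, nsmul_eq_mul, Finset.filter_congr fun t _ => hmem t,
    ← (rep T).card_class_mul_symCard]
  have h1 : ((rep T).symCard : ℝ) ≠ 0 := by exact_mod_cast (rep T).symCard_ne_zero
  have h2 : ((Finset.univ.filter fun s => rep T ≈ s).card : ℝ) ≠ 0 := by
    intro h
    have h3 := (rep T).card_class_mul_symCard
    rw [Nat.cast_eq_zero.1 h, zero_mul] at h3
    exact n.factorial_ne_zero h3.symm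
  push_cast
  field_simp

end LabeledRootedTree

/-! ### Kontsevich trees with a single edge landing on the second terrestrial vertex -/

namespace LabeledRootedTree

variable {n : ℕ}

theorem toKontsevichGraph_zero (t : LabeledRootedTree n) (k : Fin n) :
    t.toKontsevichGraph.1 k 0 = Sum.inr 0 := by
  simp [toKontsevichGraph]

theorem toKontsevichGraph_root (t : LabeledRootedTree n) :
    t.toKontsevichGraph.1 t.root 1 = Sum.inr 1 := by
  simp [toKontsevichGraph]

theorem toKontsevichGraph_parent (t : LabeledRootedTree n) {k : Fin n} (hk : k ≠ t.root) :
    t.toKontsevichGraph.1 k 1 = Sum.inl (t.parent k hk) := by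
  simp [toKontsevichGraph, hk]

theorem toKontsevichGraph_eq_inl (t : LabeledRootedTree n) (k l : Fin n) :
    t.toKontsevichGraph.1 k 1 = Sum.inl l ↔ t.Edge k l := by
  by_cases hk : k = t.root
  · subst hk
    simp [toKontsevichGraph_root, not_edge_root]
  · rw [toKontsevichGraph_parent t hk, Sum.inl_injective.eq_iff, edge_iff_parent]

theorem toKontsevichGraph_eq_inr_one (t : LabeledRootedTree n) (k : Fin n) :
    t.toKontsevichGraph.1 k 1 = Sum.inr 1 ↔ k = t.root := by
  by_cases hk : k = t.root
  · subst hk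
    simp [toKontsevichGraph_root]
  · simp [toKontsevichGraph_parent t hk, hk]

theorem interior_toKontsevichGraph (t : LabeledRootedTree n) :
    t.toKontsevichGraph.interior = t.Edge := by
  funext k l
  rw [eq_iff_iff, ← t.toKontsevichGraph_eq_inl k l]
  simp [KontsevichGraph.interior, KontsevichGraph.target, Fin.exists_fin_two,
    toKontsevichGraph_zero]

/-- Flips do not change the interior, which recovers t; the permutation at each vertex is then
recovered because the two edges have distinct targets. -/
theorem flip_toKontsevichGraph_injective : Function.Injective
    fun a : LabeledRootedTree n × (Fin n → Equiv.Perm (Fin 2)) =>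
      KontsevichGraph.flip a.2 a.1.toKontsevichGraph := by
  rintro ⟨t, s⟩ ⟨t', s'⟩ h
  have h1 := congrArg KontsevichGraph.interior h
  simp only [KontsevichGraph.flip_interior, interior_toKontsevichGraph] at h1
  obtain rfl := LabeledRootedTree.ext h1
  refine Prod.ext rfl (funext fun k => Equiv.ext fun j => ?_)
  exact t.toKontsevichGraph.target_injective k (congrFun (congrFun (congrArg Subtype.val h) k) j)

theorem incoming_inl_perm (t : LabeledRootedTree n) (k : Fin n) :
    (t.toKontsevichGraph.incoming (Sum.inl k)).Perm ((t.childList k).map fun w => (w, 1)) := by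
  rw [List.perm_ext_iff_of_nodup (KontsevichGraph.nodup_incoming _ _)
    ((nodup_childList _ _).map fun _ _ h => (Prod.ext_iff.1 h).1)]
  rintro ⟨w, j⟩
  rw [KontsevichGraph.mem_incoming, KontsevichGraph.target]
  fin_cases j
  · simp [toKontsevichGraph_zero]
  · simp [toKontsevichGraph_eq_inl, mem_childList]

theorem incoming_zero_perm (t : LabeledRootedTree n) :
    (t.toKontsevichGraph.incoming (Sum.inr 0)).Perm ((List.finRange n).map fun w => (w, 0)) := by
  rw [List.perm_ext_iff_of_nodup (KontsevichGraph.nodup_incoming _ _)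
    ((List.nodup_finRange n).map fun _ _ h => (Prod.ext_iff.1 h).1)]
  rintro ⟨w, j⟩
  rw [KontsevichGraph.mem_incoming, KontsevichGraph.target]
  have h := (t.toKontsevichGraph.2 w).2
  rw [toKontsevichGraph_zero] at h
  fin_cases j
  · simp [toKontsevichGraph_zero]
  · simpa using h.symm

theorem incoming_one (t : LabeledRootedTree n) :
    t.toKontsevichGraph.incoming (Sum.inr 1) = [(t.root, 1)] := by
  rw [← List.perm_singleton, List.perm_ext_iff_of_nodup (KontsevichGraph.nodup_incoming _ _)
    (List.nodup_singleton _)]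
  rintro ⟨w, j⟩
  rw [KontsevichGraph.mem_incoming, KontsevichGraph.target]
  fin_cases j
  · simp [toKontsevichGraph_zero]
  · simp [toKontsevichGraph_eq_inr_one]

end LabeledRootedTree

namespace KontsevichGraph

variable {n : ℕ}

/-- With all first edges on the first terrestrial vertex, at most one aerial edge leaves each
vertex. The vertex whose second edge lands on the second terrestrial vertex has none and serves as
root, so `toward_root_of_unique` orients the interior. -/
theorem exists_toKontsevichGraph_eq {Γ : KontsevichGraph n 2} (hΓ : Γ.IsTree)
    (h0 : ∀ k, Γ.1 k 0 = Sum.inr 0) (h1 : (Γ.incoming (Sum.inr 1)).length = 1) :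
    ∃ t : LabeledRootedTree n, t.toKontsevichGraph = Γ := by
  obtain ⟨⟨r, j⟩, hr⟩ := List.length_eq_one_iff.1 h1
  have hmem : ∀ e, Γ.target e = Sum.inr 1 ↔ e = (r, j) := fun e => by
    rw [← mem_incoming, hr, List.mem_singleton]
  obtain rfl : j = 1 := by
    have h := (hmem (r, j)).2 rfl
    rcases Fin.exists_fin_two.1 ⟨j, rfl⟩ with rfl | rfl
    · rw [target, h0] at h
      simp at h
    · rfl
  have hint : ∀ k l, Γ.interior k l ↔ Γ.1 k 1 = Sum.inl l := by
    intro k l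
    simp [interior, target, Fin.exists_fin_two, h0]
  let t : LabeledRootedTree n :=
    { Edge := Γ.interior
      root := r
      isTree := hΓ
      toward_root := fun v w h => LabeledRootedTree.toward_root_of_unique hΓ.2.1
        (fun w hw => by
          have h := (hmem (r, 1)).2 rfl
          rw [target, (hint r w).1 hw] at h
          simp at h)
        (fun v w w' h h' => by
          rw [hint] at h h'
          exact Sum.inl_injective (h.symm.trans h')) h }
  refine ⟨t, ext fun k j => ?_⟩
  rcases Fin.exists_fin_two.1 ⟨j, rfl⟩ with rfl | rfl
  · rw [t.toKontsevichGraph_zero, h0]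
  · by_cases hk : k = t.root
    · rw [hk, t.toKontsevichGraph_root]
      exact ((hmem (r, 1)).2 rfl).symm
    · rw [t.toKontsevichGraph_parent hk]
      exact ((hint _ _).1 (t.edge_parent k hk)).symm

/-- An edge lands on the first terrestrial vertex from every aerial vertex of a Kontsevich tree
with a single edge landing on the second one. -/
theorem exists_target_eq_zero {Γ : KontsevichGraph n 2} (hΓ : Γ.IsTree)
    (h1 : (Γ.incoming (Sum.inr 1)).length = 1) (k : Fin n) : ∃ j, Γ.1 k j = Sum.inr 0 := by
  classical
  let A := Finset.univ.filter fun e => ∃ l, Γ.target e = Sum.inl l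
  let B : Fin 2 → Finset (Fin n × Fin 2) := fun a =>
    Finset.univ.filter fun e => Γ.target e = Sum.inr a
  -- Aerial edges inject into the n - 1 edges of the underlying undirected tree; antiparallel pairs,
  -- which would be identified there, are excluded by `IsOrientedTree`.
  have hA : A.card + 1 ≤ n := by
    have h := hΓ.2.card_edgeFinset
    rw [Fintype.card_fin] at h
    refine le_trans (Nat.add_le_add_right ?_ 1) h.le
    let g : Fin n × Fin 2 → Sym2 (Fin n) := fun e =>
      Sum.elim (fun l => s(e.1, l)) (fun _ => s(e.1, e.1)) (Γ.target e)
    refine Finset.card_le_card_of_injOn g ?_ ?_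
    · rintro ⟨k, j⟩ he
      obtain ⟨l, hl⟩ := (Finset.mem_filter.1 he).2
      simp only [g, hl, Sum.elim_inl, Finset.mem_coe, SimpleGraph.mem_edgeFinset,
        SimpleGraph.mem_edgeSet, SimpleGraph.fromRel_adj]
      exact ⟨fun h => (Γ.2 k).1 j (h ▸ hl), Or.inl ⟨j, hl⟩⟩
    · rintro ⟨k, j⟩ he ⟨k', j'⟩ he' h
      obtain ⟨l, hl⟩ := (Finset.mem_filter.1 he).2
      obtain ⟨l', hl'⟩ := (Finset.mem_filter.1 he').2
      simp only [g, hl, hl', Sum.elim_inl, Sym2.eq_iff] at h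
      rcases h with ⟨rfl, rfl⟩ | ⟨rfl, rfl⟩
      · exact Prod.ext rfl (Γ.target_injective _ (hl.trans hl'.symm))
      · exact absurd ⟨j', hl'⟩ (hΓ.1 _ _ ⟨j, hl⟩)
  have hB : (B 1).card = 1 := by
    rwa [incoming, Finset.length_toList] at h1
  have hcover : (Finset.univ : Finset (Fin n × Fin 2)) = A ∪ (B 0 ∪ B 1) := by
    ext e
    simp only [A, B, Finset.mem_univ, Finset.mem_union, Finset.mem_filter, true_and, true_iff]
    rcases hte : Γ.target e with l | a
    · simp
    · rcases Fin.exists_fin_two.1 ⟨a, rfl⟩ with rfl | rfl <;> simp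
  have hcard := congrArg Finset.card hcover
  rw [Finset.card_univ, Fintype.card_prod, Fintype.card_fin, Fintype.card_fin] at hcard
  have hle := Finset.card_union_le A (B 0 ∪ B 1)
  have hle' := Finset.card_union_le (B 0) (B 1)
  have himg : ((B 0).image Prod.fst).card = (B 0).card := by
    refine Finset.card_image_of_injOn ?_
    rintro ⟨k, j⟩ he ⟨k', j'⟩ he' (rfl : k = k')
    exact Prod.ext rfl (Γ.target_injective k
      ((Finset.mem_filter.1 he).2.trans (Finset.mem_filter.1 he').2.symm))
  -- The covering gives 2n ≤ (n - 1) + |B 0| + 1, so |B 0| ≥ n, while each vertex contributes at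
  -- most one edge to `B 0`.
  have huniv : (B 0).image Prod.fst = Finset.univ := by
    refine Finset.eq_univ_of_card _ (le_antisymm (Finset.card_le_univ _) ?_)
    rw [himg, Fintype.card_fin]
    omega
  obtain ⟨⟨k', j⟩, he, rfl⟩ := Finset.mem_image.1 (huniv ▸ Finset.mem_univ k)
  exact ⟨j, (Finset.mem_filter.1 he).2⟩

theorem exists_flip_toKontsevichGraph_eq {Γ : KontsevichGraph n 2} (hΓ : Γ.IsTree)
    (h1 : (Γ.incoming (Sum.inr 1)).length = 1) :
    ∃ (t : LabeledRootedTree n) (s : Fin n → Equiv.Perm (Fin 2)),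
      flip s t.toKontsevichGraph = Γ := by
  choose j hj using exists_target_eq_zero hΓ h1
  -- The swap brings the edge landing on the first terrestrial vertex into first position; being an
  -- involution, it also undoes the normalization.
  let s : Fin n → Equiv.Perm (Fin 2) := fun k => Equiv.swap 0 (j k)
  obtain ⟨t, ht⟩ := exists_toKontsevichGraph_eq (Γ := flip s Γ)
    (by rwa [IsTree, flip_interior]) (fun k => by simp [flip, s, hj])
    (by rwa [← (flip_incoming s Γ _).length_eq, List.length_map] at h1)
  refine ⟨t, s, ext fun k j => ?_⟩
  rw [ht]
  simp [flip, s]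

end KontsevichGraph

/-! ### The derivative of the symbol with respect to the second momentum -/

namespace KontsevichGraph

variable {n d : ℕ}

/-- The derivative `∂B̂_Γ(π)/∂p_{2,i}` at `(p, 0, x)`. -/
noncomputable def symbolDeriv (Γ : KontsevichGraph n 2) (π : (Fin d → ℝ) → Fin d → Fin d → ℝ)
    (i : Fin d) (p x : Fin d → ℝ) : ℝ :=
  ∑ I : Fin n × Fin 2 → Fin d,
    (∏ k : Fin n, iterPartialDeriv ((Γ.incoming (Sum.inl k)).map I)
        (fun y => π y (I (k, 0)) (I (k, 1))) x)
      * (((Γ.incoming (Sum.inr 0)).map I).map p).prod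
      * linearCoeff i ((Γ.incoming (Sum.inr 1)).map I)

/-- Each edge landing on a terrestrial vertex differentiates an exponential and yields one momentum
factor; the exponentials cancel against the denominator. -/
theorem symbol_eq (Γ : KontsevichGraph n 2) (π : (Fin d → ℝ) → Fin d → Fin d → ℝ)
    (p q x : Fin d → ℝ) :
    Γ.symbol π ![p, q] x = ∑ I : Fin n × Fin 2 → Fin d,
      (∏ k : Fin n, iterPartialDeriv ((Γ.incoming (Sum.inl k)).map I)
          (fun y => π y (I (k, 0)) (I (k, 1))) x)
        * (((Γ.incoming (Sum.inr 0)).map I).map p).prod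
        * (((Γ.incoming (Sum.inr 1)).map I).map q).prod := by
  rw [symbol, operator, Finset.sum_div]
  refine Finset.sum_congr rfl fun I _ => ?_
  rw [div_eq_iff (Real.exp_pos _).ne']
  simp only [Fin.sum_univ_two, Fin.prod_univ_two, Matrix.cons_val_zero, Matrix.cons_val_one,
    iterPartialDeriv_exp, add_dotProduct, Real.exp_add]
  ring

/-- Differentiability is recorded together with the value so that the derivative can be taken inside
the finite sum over trees. -/
theorem hasFDerivAt_symbol (Γ : KontsevichGraph n 2) (π : (Fin d → ℝ) → Fin d → Fin d → ℝ)
    (p x : Fin d → ℝ) : ∃ L : (Fin d → ℝ) →L[ℝ] ℝ,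
      HasFDerivAt (fun q => Γ.symbol π ![p, q] x) L 0 ∧
        ∀ i, L (Pi.single i 1) = Γ.symbolDeriv π i p x := by
  choose L hL hL' using fun I : Fin n × Fin 2 → Fin d =>
    hasFDerivAt_prod_map ((Γ.incoming (Sum.inr 1)).map I)
  simp only [symbol_eq]
  refine ⟨_, HasFDerivAt.fun_sum fun I _ => (hL I).const_mul _, fun i => ?_⟩
  simp [symbolDeriv, hL']

theorem partialDeriv_sum_symbol {ι : Type*} [Fintype ι] (Γ : ι → KontsevichGraph n 2) (c : ℝ)
    (W : ι → ℝ) (π : (Fin d → ℝ) → Fin d → Fin d → ℝ) (i : Fin d) (p x : Fin d → ℝ) :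
    partialDeriv i (fun q => c * ∑ a, W a * (Γ a).symbol π ![p, q] x) 0
      = c * ∑ a, W a * (Γ a).symbolDeriv π i p x := by
  choose L hL hL' using fun a => (Γ a).hasFDerivAt_symbol π p x
  have h : HasFDerivAt (fun q => c * ∑ a, W a * (Γ a).symbol π ![p, q] x)
      (c • ∑ a, W a • L a) 0 :=
    (HasFDerivAt.fun_sum fun a _ => (hL a).const_mul (W a)).const_mul c
  rw [partialDeriv, h.fderiv]
  simp [hL']

/-- A monomial in p_2 of degree other than one has no linear part at the origin. -/
theorem symbolDeriv_eq_zero {Γ : KontsevichGraph n 2} (π : (Fin d → ℝ) → Fin d → Fin d → ℝ)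
    (i : Fin d) (p x : Fin d → ℝ) (h : (Γ.incoming (Sum.inr 1)).length ≠ 1) :
    Γ.symbolDeriv π i p x = 0 := by
  refine Finset.sum_eq_zero fun I _ => ?_
  rw [linearCoeff, if_neg, mul_zero]
  intro h'
  exact h (by simpa using congrArg List.length h')

theorem _root_.linearCoeff_perm {i : Fin d} {l l' : List (Fin d)} (h : l.Perm l') :
    linearCoeff i l = linearCoeff i l' := by
  unfold linearCoeff
  refine if_congr ?_ rfl rfl
  rw [← List.perm_singleton, ← List.perm_singleton]
  exact ⟨h.symm.trans, h.trans⟩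

theorem _root_.antisymm_perm {ρ : Fin d → Fin d → ℝ} (hρ : ∀ i j, ρ i j = -ρ j i)
    (s : Equiv.Perm (Fin 2)) (a : Fin 2 → Fin d) :
    ρ (a (s 0)) (a (s 1)) = ((Equiv.Perm.sign s : ℤ) : ℝ) * ρ (a 0) (a 1) := by
  have hs : s = 1 ∨ s = Equiv.swap 0 1 := by
    revert s
    decide
  rcases hs with rfl | rfl
  · simp
  · rw [Equiv.Perm.sign_swap (by decide), Equiv.swap_apply_left, Equiv.swap_apply_right, hρ]
    simp

/-- Transporting the index assignment along the edge permutation leaves all derivatives and momentum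
factors in place and only permutes the two indices of π at each vertex. -/
theorem symbolDeriv_flip {π : (Fin d → ℝ) → Fin d → Fin d → ℝ}
    (hs : ∀ i j, ContDiff ℝ ∞ fun y => π y i j) (ha : ∀ y i j, π y i j = -π y j i)
    (s : Fin n → Equiv.Perm (Fin 2)) (Γ : KontsevichGraph n 2) (i : Fin d) (p x : Fin d → ℝ) :
    (flip s Γ).symbolDeriv π i p x
      = (∏ k, ((Equiv.Perm.sign (s k) : ℤ) : ℝ)) * Γ.symbolDeriv π i p x := by
  unfold symbolDeriv
  rw [Finset.mul_sum]
  refine (Fintype.sum_equiv (Equiv.arrowCongr (Equiv.prodCongrRight s).symm (Equiv.refl _))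
    _ _ fun J => ?_).symm
  have hJ : Equiv.arrowCongr (Equiv.prodCongrRight s).symm (Equiv.refl (Fin d)) J
      = J ∘ Equiv.prodCongrRight s := rfl
  have hperm : ∀ v, (((flip s Γ).incoming v).map (J ∘ Equiv.prodCongrRight s)).Perm
      ((Γ.incoming v).map J) := by
    intro v
    rw [← List.map_map]
    exact (flip_incoming s Γ v).map J
  rw [hJ, linearCoeff_perm (hperm _), ((hperm (Sum.inr 0)).map p).prod_eq, ← mul_assoc,
    ← mul_assoc, ← Finset.prod_mul_distrib]
  congr 2
  refine Finset.prod_congr rfl fun k _ => ?_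
  rw [iterPartialDeriv_perm (hs _ _) (hperm _)]
  have h : (fun y => π y ((J ∘ Equiv.prodCongrRight s) (k, 0)) ((J ∘ Equiv.prodCongrRight s) (k, 1)))
      = fun y => ((Equiv.Perm.sign (s k) : ℤ) : ℝ) * π y (J (k, 0)) (J (k, 1)) :=
    funext fun y => antisymm_perm (ha y) (s k) fun j => J (k, j)
  rw [h, iterPartialDeriv_const_mul (hs _ _)]

end KontsevichGraph

/-! ### The symbol of Γ_t as an elementary differential -/

namespace LabeledRootedTree

variable {n d : ℕ}

/-- An index assignment splits into labels a of the first edges and b of the second edges. Only b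
enters the derivatives at aerial vertices, so the sum over a factors over the vertices and contracts
each π with p. What remains is the sum over labelings b in `elemDiff_eq_sum`, the edge from the root
fixing its label to be i. -/
theorem symbolDeriv_toKontsevichGraph {π : (Fin d → ℝ) → Fin d → Fin d → ℝ}
    (hs : ∀ i j, ContDiff ℝ ∞ fun y => π y i j) (t : LabeledRootedTree n) (i : Fin d)
    (p x : Fin d → ℝ) :
    t.toKontsevichGraph.symbolDeriv π i p x = t.elemDiff (fun y j => ∑ a, π y a j * p a) i x := by
  classical
  rw [elemDiff_eq_sum, KontsevichGraph.symbolDeriv]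
  let e : (Fin n → Fin d) × (Fin n → Fin d) ≃ (Fin n × Fin 2 → Fin d) :=
    { toFun := fun c q => ![c.1 q.1, c.2 q.1] q.2
      invFun := fun I => (fun k => I (k, 0), fun k => I (k, 1))
      left_inv := fun c => rfl
      right_inv := fun I => by
        funext ⟨k, j⟩
        fin_cases j <;> rfl }
  rw [← e.sum_comp, Fintype.sum_prod_type_right]
  refine Finset.sum_congr rfl fun b _ => ?_
  have he : ∀ (a : Fin n → Fin d) k, e (a, b) (k, 0) = a k ∧ e (a, b) (k, 1) = b k :=
    fun a k => ⟨rfl, rfl⟩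
  have hin : ∀ a k, ((t.toKontsevichGraph.incoming (Sum.inl k)).map (e (a, b))).Perm
      ((t.childList k).map b) := by
    intro a k
    simpa [Function.comp_def, he] using (t.incoming_inl_perm k).map (e (a, b))
  have h0 : ∀ a, (((t.toKontsevichGraph.incoming (Sum.inr 0)).map (e (a, b))).map p).prod
      = ∏ k, p (a k) := by
    intro a
    rw [((t.incoming_zero_perm.map (e (a, b))).map p).prod_eq]
    simp [Function.comp_def, he, Fin.prod_univ_def]
  have h1 : ∀ a, linearCoeff i ((t.toKontsevichGraph.incoming (Sum.inr 1)).map (e (a, b)))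
      = if b t.root = i then 1 else 0 := by
    intro a
    simp [linearCoeff, incoming_one, he]
  simp only [h0, h1, he, ← Finset.prod_mul_distrib, iterPartialDeriv_perm (hs _ _) (hin _ _)]
  rw [← Finset.sum_mul, mul_ite, mul_one, mul_zero]
  refine if_congr Iff.rfl ?_ rfl
  have hlin : ∀ k, iterPartialDeriv ((t.childList k).map b) (fun y => ∑ a, π y a (b k) * p a) x
      = ∑ a, iterPartialDeriv ((t.childList k).map b) (fun y => π y a (b k)) x * p a := by
    intro k
    have hc : (fun y => ∑ a, π y a (b k) * p a) = fun y => ∑ a, p a * π y a (b k) := by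
      simp only [mul_comm]
    rw [hc, iterPartialDeriv_sum _ fun a => contDiff_const.mul (hs a (b k))]
    simp only [iterPartialDeriv_const_mul (hs _ _), mul_comm]
  simp only [hlin, Finset.prod_univ_sum, Fintype.piFinset_univ]

/-- The vector field enters once for each of the n vertices. -/
theorem elemDiff_const_mul {X : (Fin d → ℝ) → Fin d → ℝ}
    (hX : ∀ u, ContDiff ℝ ∞ fun y => X y u) (t : LabeledRootedTree n) (c : ℝ) (u : Fin d)
    (x : Fin d → ℝ) :
    t.elemDiff (fun y j => c * X y j) u x = c ^ n * t.elemDiff X u x := by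
  classical
  simp only [elemDiff_eq_sum, iterPartialDeriv_const_mul (hX _), Finset.prod_mul_distrib,
    Finset.prod_const, Finset.card_univ, Fintype.card_fin, Finset.mul_sum, mul_ite, mul_zero]

end LabeledRootedTree

/-! ### The Kontsevich realization -/

theorem PoissonStructure.contDiff_flatSpray {d : ℕ} (π : PoissonStructure d) (p : Fin d → ℝ)
    (j : Fin d) : ContDiff ℝ ∞ fun x => π.flatSpray p x j :=
  ContDiff.sum fun i _ => (π.smooth i j).mul contDiff_const

open Classical in
theorem sum_weight_mul_symbolDeriv {d n : ℕ} (π : PoissonStructure d) (i : Fin d)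
    (p x : Fin d → ℝ) :
    ∑ Γ : {Γ : KontsevichGraph n 2 // Γ.IsTree},
        Γ.1.weight * Γ.1.symbolDeriv (fun y j k => π.coeff y j k / 2) i p x
      = ∑ t : LabeledRootedTree n, t.toKontsevichGraph.weight * t.elemDiff (π.flatSpray p) i x := by
  have hs : ∀ j k, ContDiff ℝ ∞ fun y => π.coeff y j k / 2 := fun j k =>
    (π.smooth j k).div_const 2
  have ha : ∀ y j k, π.coeff y j k / 2 = -(π.coeff y k j / 2) := fun y j k => by
    rw [π.antisymm y j k]
    ring
  have hhalf : ∀ t : LabeledRootedTree n, t.toKontsevichGraph.symbolDeriv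
      (fun y j k => π.coeff y j k / 2) i p x = (1 / 2) ^ n * t.elemDiff (π.flatSpray p) i x := by
    intro t
    rw [LabeledRootedTree.symbolDeriv_toKontsevichGraph hs,
      ← LabeledRootedTree.elemDiff_const_mul (π.contDiff_flatSpray p)]
    congr 1
    funext y j
    rw [PoissonStructure.flatSpray, Finset.mul_sum]
    exact Finset.sum_congr rfl fun a _ => by ring
  have htree : ∀ a : LabeledRootedTree n × (Fin n → Equiv.Perm (Fin 2)),
      (KontsevichGraph.flip a.2 a.1.toKontsevichGraph).IsTree := fun a => by
    rw [KontsevichGraph.IsTree, KontsevichGraph.flip_interior,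
      LabeledRootedTree.interior_toKontsevichGraph]
    exact a.1.isTree
  -- The sum is reindexed by pairs of a labeled rooted tree and a choice of edge orders; Kontsevich
  -- trees not of this form contribute zero.
  rw [← Fintype.sum_of_injective (fun a => (⟨_, htree a⟩ : {Γ : KontsevichGraph n 2 // Γ.IsTree}))
    (fun a b h => LabeledRootedTree.flip_toKontsevichGraph_injective (congrArg Subtype.val h))
    (fun a => (1 / 2) ^ n *
      (a.1.toKontsevichGraph.weight * a.1.elemDiff (π.flatSpray p) i x)) _ ?_ ?_]
  · rw [Fintype.sum_prod_type]
    refine Finset.sum_congr rfl fun t _ => ?_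
    dsimp only
    -- The summand does not depend on the edge orders, and their number 2^n cancels (1/2)^n.
    rw [Finset.sum_const, Finset.card_univ, Fintype.card_fun, Fintype.card_perm, Fintype.card_fin,
      Fintype.card_fin, nsmul_eq_mul, ← mul_assoc]
    simp
  · rintro ⟨Γ, hΓ⟩ hr
    rw [KontsevichGraph.symbolDeriv_eq_zero, mul_zero]
    intro h1
    obtain ⟨t, s, h⟩ := KontsevichGraph.exists_flip_toKontsevichGraph_eq hΓ h1
    exact hr ⟨(t, s), Subtype.ext h⟩
  · intro a
    -- The flip sign occurs once in the weight and once in the symbol.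
    have hsq : (∏ k, ((Equiv.Perm.sign (a.2 k) : ℤ) : ℝ)) * ∏ k, ((Equiv.Perm.sign (a.2 k) : ℤ) : ℝ)
        = 1 := by
      rw [← Finset.prod_mul_distrib]
      refine Finset.prod_eq_one fun k _ => ?_
      rcases Int.units_eq_one_or (Equiv.Perm.sign (a.2 k)) with h | h <;> simp [h]
    rw [KontsevichGraph.weight_flip, KontsevichGraph.symbolDeriv_flip hs ha, hhalf]
    linear_combination (-(1 / 2) ^ n *
      (a.1.toKontsevichGraph.weight * a.1.elemDiff (π.flatSpray p) i x)) * hsq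

theorem coeff_zero_kontsevichRealization {d : ℕ} (π : PoissonStructure d) (i : Fin d) :
    PowerSeries.coeff 0 (kontsevichRealization π i) = fun _ x => x i := by
  funext p x
  have h : HasFDerivAt (fun q : Fin d → ℝ => (p + q) ⬝ᵥ x)
      (∑ j, x j • (ContinuousLinearMap.proj j : (Fin d → ℝ) →L[ℝ] ℝ)) 0 := by
    unfold dotProduct
    exact HasFDerivAt.fun_sum fun j _ => ((hasFDerivAt_apply j _).const_add (p j)).mul_const (x j)
  simp only [kontsevichRealization, generatingFunction, PowerSeries.coeff_mk, if_true, partialDeriv]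
  rw [h.fderiv]
  simp [Pi.single_apply]

theorem coeff_kontsevichRealization {d n : ℕ} (π : PoissonStructure d) (i : Fin d) (hn : n ≠ 0)
    (p x : Fin d → ℝ) :
    PowerSeries.coeff n (kontsevichRealization π i) p x = (1 / (n.factorial : ℝ)) *
      ∑ t : LabeledRootedTree n, t.toKontsevichGraph.weight * t.elemDiff (π.flatSpray p) i x := by
  classical
  simp only [kontsevichRealization, generatingFunction, PowerSeries.coeff_mk, if_neg hn]
  rw [KontsevichGraph.partialDeriv_sum_symbol, sum_weight_mul_symbolDeriv]

/-- `s_K^i = x^i + ∑_{T ∈ [RT]} ε^{|T|} (W_T / |sym T|) D_T^i L_V`, where `W_T`, `sym T` and `D_T`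
are computed from an arbitrary representative of `T`. -/
theorem theorem4 {d : ℕ} (π : PoissonStructure d) (i : Fin d)
    (rep : (T : TopRootedTree) → LabeledRootedTree T.degree) (hrep : ∀ T : TopRootedTree, T.IsRep (rep T)) :
    HasSum
      (fun T : TopRootedTree =>
        (PowerSeries.monomial T.degree (fun p x =>
          (rep T).toKontsevichGraph.weight / ((rep T).symCard : ℝ)
            * (rep T).elemDiff (π.flatSpray p) i x) :
          ((Fin d → ℝ) → (Fin d → ℝ) → ℝ)⟦X⟧))
      (kontsevichRealization π i - PowerSeries.C (fun _p x => x i)) := by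
  classical
  rw [PowerSeries.WithPiTopology.hasSum_iff_hasSum_coeff]
  intro n
  let ι : Quotient (LabeledRootedTree.setoid n) → TopRootedTree := fun T => ⟨n, T⟩
  have hinj : Function.Injective ι := fun T T' h =>
    eq_of_heq (Sigma.mk.inj h).2
  -- Only the finitely many classes with n vertices contribute to the coefficient of ε^n, so
  -- summability reduces to a finite sum.
  rw [← hinj.hasSum_iff]
  · convert hasSum_fintype _ using 1
    rw [map_sub, PowerSeries.coeff_C]
    funext p x
    rw [Finset.sum_apply, Finset.sum_apply]
    by_cases hn : n = 0
    · subst hn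
      -- A rooted tree has a root, so no class has zero vertices; the constant coefficient is
      -- exactly the subtracted x^i.
      have : IsEmpty (Quotient (LabeledRootedTree.setoid 0)) :=
        ⟨fun T => (rep ⟨0, T⟩).root.elim0⟩
      rw [coeff_zero_kontsevichRealization]
      simp
    · rw [if_neg hn, sub_zero, coeff_kontsevichRealization π i hn,
        LabeledRootedTree.sum_eq_sum_quotient _ _ (fun T => rep (ι T)) fun T => hrep (ι T)]
      · refine Finset.sum_congr rfl fun T _ => ?_
        simp only [Function.comp_apply]
        rw [PowerSeries.coeff_monomial, if_pos (show n = (ι T).degree from rfl)]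
        exact (div_mul_eq_mul_div _ _ _).symm
      · rintro s t ⟨f⟩
        rw [LabeledRootedTree.weight_congr f,
          LabeledRootedTree.elemDiff_congr f (π.contDiff_flatSpray p)]
  · rintro ⟨m, T⟩ hT
    rw [PowerSeries.coeff_monomial, if_neg]
    rintro rfl
    exact hT ⟨T, rfl⟩
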